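/- There are an integer $r$ and a function $f:\mathbb N\to\mathbb N$ such that the following holds. Let $L$ be a finite simplicial complex of dimension $d$ in which every vertex is contained in at most $R$ simplices. Suppose that the link of every $(d-1)$-simplex of $L$ consists of exactly two vertices, and that the link of every simplex of $L$ of positive dimension has even Euler characteristic (both hold, for instance, if $d\ge 1$ and $L$ is a combinatorial manifold, where every link is homeomorphic to a sphere). Let $L'$ be the barycentric subdivision of $L$: its vertices are (the barycenters of) the simplices of $L$, and its simplices are the nonempty chains $\sigma_0<\dots<\sigma_k$ of simplices of $L$. For a finite simplicial complex $K$ put one qubit on each vertex, with basis states $|0\rangle=|{\uparrow}\rangle$, $|1\rangle=|{\downarrow}\rangle$, and $|+\rangle=(|0\rangle+|1\rangle)/\sqrt2$. The GDS dual state on $K$ is $\prod_{k\ge 0}\prod_{\Delta^k\in K} C^kZ_{\Delta^k}\,|+\rangle^{\otimes K^{(0)}}$, where $C^kZ_\Delta$ is the diagonal gate equal to $-1$ if all $k+1$ qubits on the vertices of $\Delta$ are $\downarrow$ and to $+1$ otherwise. Let $G=\mathbb Z_2\times\mathbb Z_2^T$ act on qubits, $\mathbb Z_2$ by flipping all spins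 and $\mathbb Z_2^T$ (time reversal) by complex conjugation in the computational basis. Then there is a quantum circuit $C$ on the qubits at the vertices of $L'$ such that - every gate of $C$ commutes with the action of $G$; - the support of every gate of $C$ has diameter at most $r$ in the graph of vertices and edges of $L'$; - $C$ consists of at most $f(R)$ layers of gates with pairwise disjoint supports; - $C$ maps the GDS dual state on $L$, tensored with $|+\rangle$ on the barycenters of all simplices of $L$ of nonzero dimension, exactly to the GDS dual state on $L'$. -/

import Mathlib

namespace GDSDual

/-! ### Finite simplicial complexes -/

section Complexes

variable {V : Type*} [DecidableEq V]

/-- The largest dimension of a simplex of `L` is `d`. -/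
def HasDimension (L : AbstractSimplicialComplex V) (d : ℕ) : Prop :=
  (∀ s ∈ L.faces, s.card ≤ d + 1) ∧ ∃ s ∈ L.faces, s.card = d + 1

/-- The link of `s`: the simplices disjoint from `s` whose union with `s` is a simplex. -/
def link (L : AbstractSimplicialComplex V) (s : Finset V) : PreAbstractSimplicialComplex V where
  faces := {t | t ∈ L.faces ∧ Disjoint t s ∧ t ∪ s ∈ L.faces}
  isRelLowerSet_faces := by
    rintro t ⟨ht, hd, hu⟩
    refine ⟨(L.isRelLowerSet_faces ht).1, fun t' htt' hne => ?_⟩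
    refine ⟨(L.isRelLowerSet_faces ht).2 htt' hne, hd.mono_left htt', ?_⟩
    exact (L.isRelLowerSet_faces hu).2 (Finset.union_subset_union htt' (Finset.Subset.refl s))
      (hne.mono Finset.subset_union_left)

open Classical in
/-- The Euler characteristic of a finite complex, the sum of `(-1) ^ dim t` over its simplices
(all of them nonempty); it is `0` for the complex without simplices. -/
noncomputable def eulerChar [Fintype V] (K : PreAbstractSimplicialComplex V) : ℤ :=
  ∑ t : Finset V with t ∈ K.faces, (-1) ^ (t.card - 1)

/-- Every vertex lies in at most `R` simplices. -/
def VertexBound (L : AbstractSimplicialComplex V) (R : ℕ) : Prop :=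
  ∀ v : V, {s : Finset V | s ∈ L.faces ∧ v ∈ s}.ncard ≤ R

/-- The vertices of the barycentric subdivision of `L`: the barycenters of the simplices of `L`. -/
abbrev Barycenter (L : AbstractSimplicialComplex V) : Type _ := {s : Finset V // s ∈ L.faces}

noncomputable instance [Fintype V] (L : AbstractSimplicialComplex V) : Fintype (Barycenter L) :=
  Fintype.ofFinite {s : Finset V // s ∈ L.faces}

/-- The barycentric subdivision: its simplices are the nonempty finite chains
`σ₀ < σ₁ < ⋯ < σₖ` of simplices of `L`. -/
def barycentricSubdivision (L : AbstractSimplicialComplex V) :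
    AbstractSimplicialComplex (Barycenter L) where
  faces := {c | c.Nonempty ∧ IsChain (fun s t : Barycenter L => s.1 ⊆ t.1) (c : Set (Barycenter L))}
  isRelLowerSet_faces := by
    rintro c ⟨hne, hc⟩
    exact ⟨hne, fun c' hcc' hne' => ⟨hne', hc.mono (Finset.coe_subset.2 hcc')⟩⟩
  singleton_mem := fun s => ⟨Finset.singleton_nonempty s, by
    rw [Finset.coe_singleton]; exact Set.subsingleton_singleton.isChain⟩

/-- The graph of vertices and edges of a complex. -/
def oneSkeleton (L : AbstractSimplicialComplex V) : SimpleGraph V where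
  Adj u v := u ≠ v ∧ ({u, v} : Finset V) ∈ L.faces
  symm := ⟨fun u v h => ⟨h.1.symm, by rw [Finset.pair_comm]; exact h.2⟩⟩
  loopless := ⟨fun _ h => h.1 rfl⟩

/-- The barycenters of the simplices of nonzero dimension. -/
abbrev NewVertex (L : AbstractSimplicialComplex V) : Type _ :=
  {b : Barycenter L // 2 ≤ b.1.card}

/-- The vertices of the barycentric subdivision are the vertices of `L` and the barycenters of the
simplices of nonzero dimension. -/
noncomputable def vertexSplit (L : AbstractSimplicialComplex V) :
    V ⊕ NewVertex L ≃ Barycenter L :=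
  Equiv.ofBijective
    (Sum.elim (fun v => (⟨{v}, L.singleton_mem v⟩ : Barycenter L)) (fun b => b.1)) <| by
    constructor
    · rintro (v | ⟨⟨s, hs⟩, hb⟩) (w | ⟨⟨t, ht⟩, hb'⟩) h
      · have := congrArg Subtype.val h
        simpa using this
      · have := congrArg Subtype.val h
        simp only [Sum.elim_inl, Sum.elim_inr] at this
        simp only [← this, Finset.card_singleton] at hb'
        omega
      · have := congrArg Subtype.val h
        simp only [Sum.elim_inl, Sum.elim_inr] at this
        simp only [this, Finset.card_singleton] at hb
        omega
      · exact congrArg Sum.inr (Subtype.ext h)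
    · rintro ⟨s, hs⟩
      by_cases h : 2 ≤ s.card
      · exact ⟨Sum.inr ⟨⟨s, hs⟩, h⟩, rfl⟩
      · have h0 : 0 < s.card := Finset.card_pos.2 (L.isRelLowerSet_faces hs).1
        obtain ⟨v, rfl⟩ := Finset.card_eq_one.1 (show s.card = 1 by omega)
        exact ⟨Sum.inl v, rfl⟩

end Complexes

/-! ### Qubits, states, symmetric circuits -/

section Qubits

/-- Computational basis configurations of qubits at the sites `Q`; `0` is `↑` and `1` is `↓`. -/
abbrev Config (Q : Type*) := Q → ZMod 2

/-- Vectors of the Hilbert space `(ℂ²)^{⊗ Q}`, given by their amplitudes. -/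
abbrev State (Q : Type*) := Config Q → ℂ

/-- Operators on `(ℂ²)^{⊗ Q}`. -/
abbrev Op (Q : Type*) := Matrix (Config Q) (Config Q) ℂ

/-- The one-qubit state `(|0⟩ + |1⟩) / √2`. -/
noncomputable def ketPlus : ZMod 2 → ℂ := fun _ => ((√2 : ℝ) : ℂ)⁻¹

/-- The product state with all qubits in `|+⟩`. -/
noncomputable def plusState (Q : Type*) [Fintype Q] : State Q := fun x => ∏ q, ketPlus (x q)

/-- The tensor product of a state on the sites `A` and a state on the sites `B`, where the sites
`C` are split into `A` and `B` by `e`. -/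
def tensorState {A B C : Type*} (e : A ⊕ B ≃ C) (ψ : State A) (φ : State B) : State C :=
  fun x => ψ (fun a => x (e (Sum.inl a))) * φ (fun b => x (e (Sum.inr b)))

/-- The action of `(a, t) ∈ ℤ₂ × ℤ₂ᵀ`: the internal generator flips all spins, the time reversal
generator is complex conjugation in the computational basis (an antilinear map). -/
def symmetryAction {Q : Type*} (g : ZMod 2 × ZMod 2) (ψ : State Q) : State Q :=
  fun x => if g.2 = 0 then ψ (fun q => x q - g.1) else starRingEnd ℂ (ψ (fun q => x q - g.1))

variable {Q : Type*} [Fintype Q] [DecidableEq Q]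

/-- `U = u ⊗ 1` for some operator `u` on the qubits in `S`. -/
def SupportedOn (S : Finset Q) (U : Op Q) : Prop :=
  ∃ u : Op S, ∀ x y : Config Q,
    U x y = if ∀ q, q ∉ S → x q = y q then u (fun q => x q) (fun q => y q) else 0

/-- A quantum gate: a unitary acting on the qubits in `support`. -/
structure Gate (Q : Type*) [Fintype Q] [DecidableEq Q] where
  support : Finset Q
  op : Op Q
  unitary : op ∈ Matrix.unitaryGroup (Config Q) ℂ
  supported : SupportedOn support op

/-- The gate commutes with the action of `ℤ₂ × ℤ₂ᵀ`. -/
def Gate.IsSymmetric (g : Gate Q) : Prop :=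
  ∀ (h : ZMod 2 × ZMod 2) (ψ : State Q),
    g.op.mulVec (symmetryAction h ψ) = symmetryAction h (g.op.mulVec ψ)

/-- A quantum circuit: a list of layers, each a list of gates with pairwise disjoint supports. -/
structure Circuit (Q : Type*) [Fintype Q] [DecidableEq Q] where
  layers : List (List (Gate Q))
  disjoint : ∀ l ∈ layers, l.Pairwise fun g h => Disjoint g.support h.support

/-- The number of layers. -/
def Circuit.depth (c : Circuit Q) : ℕ := c.layers.length

/-- The action on states, layer after layer. -/
def Circuit.apply (c : Circuit Q) (ψ : State Q) : State Q :=
  c.layers.foldl (fun φ l => l.foldl (fun χ g => g.op.mulVec χ) φ) ψ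

/-- Every gate is `ℤ₂ × ℤ₂ᵀ`-symmetric. -/
def Circuit.IsLocallySymmetric (c : Circuit Q) : Prop :=
  ∀ l ∈ c.layers, ∀ g ∈ l, g.IsSymmetric

/-- The qubits sit on the vertices of `K`, and any two qubits in the support of a gate are at
distance at most `r` in the graph of vertices and edges of `K`. -/
def Circuit.HasRange (c : Circuit Q) (K : AbstractSimplicialComplex Q) (r : ℕ) : Prop :=
  ∀ l ∈ c.layers, ∀ g ∈ l, ∀ p ∈ g.support, ∀ q ∈ g.support, (oneSkeleton K).edist p q ≤ r

/-- The gate `CᵏZ` on the `k + 1` qubits in `s`: the sign is `-1` if they are all `↓`. -/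
def ckZ (s : Finset Q) : Op Q := Matrix.diagonal fun x => if ∀ q ∈ s, x q = 1 then -1 else 1

open Classical in
/-- The disentangler of a complex: the product of `CᵏZ` over all its `k`-simplices, for all `k`
(the gates are diagonal, so the product is taken entry by entry). -/
noncomputable def disentangler (K : AbstractSimplicialComplex Q) : Op Q :=
  Matrix.diagonal fun x => ∏ s : Finset Q with s ∈ K.faces, ckZ s x x

/-- The GDS dual state on a complex, with one qubit at each vertex. -/
noncomputable def gdsDualState (K : AbstractSimplicialComplex Q) : State Q :=
  (disentangler K).mulVec (plusState Q)

end Qubits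

end GDSDual

/-!
Let `N_K x` be the number of simplices of `K` all of whose vertices are `↓` in `x`. The GDS dual
state on `K` has sign `(-1) ^ N_K x`, so the circuit must multiply the amplitude of a configuration
`x` on the barycenters by the sign of `N_{L'} x - N_L (x|_V)`. Choose a vertex of every simplex, and
let every barycenter copy the spin of the chosen vertex of its simplex; summing over the chains with
a given largest simplex shows that `N_{L'}` of the new configuration is `N_L (x|_V)` modulo two.
Replacing the spins one at a time writes the sign as a product of one gate for each barycenter, and
since only the chains through that barycenter see the replacement, the gate is local.

The gates are real, so they commute with time reversal. They commute with the global spin flip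
because modulo two the change of `N_{L'}` under the flip depends only on the spins at the vertices
of `L`, which are never replaced. Indeed, since intervals of simplices have even cardinality, the
flip does not change the parity of the number of `↓` chains strictly below a simplex `τ`. Hence it
changes `N_{L'}` by the number of pairs of such a chain, possibly empty, and `τ`. A chain with
largest simplex `σ` occurs in as many pairs as there are simplices above `σ`; modulo two this is the
Euler characteristic of the link of `σ`, which is even unless `σ` is a vertex of `L`.
-/

namespace GDSDual

open Finset

/-! ### Chain sums in posets -/

section ChainSums

variable {α R : Type*} [PartialOrder α]

open Classical in
/-- The generating function of the order complex of `S`: the sum of the products of the values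
of `y` over all chains in `S`, the empty chain included. -/
noncomputable def chainSum [CommSemiring R] (y : α → R) (S : Finset α) : R :=
  ∑ c ∈ S.powerset.filter (fun c : Finset α => IsChain (· ≤ ·) (c : Set α)), ∏ a ∈ c, y a

theorem isChain_insert_iff_of_not_le {m : α} {c : Set α} (hm : ∀ a ∈ c, ¬m ≤ a) :
    IsChain (· ≤ ·) (insert m c) ↔ IsChain (· ≤ ·) c ∧ ∀ a ∈ c, a < m := by
  refine ⟨fun h => ⟨h.mono (Set.subset_insert m c), fun a ha => ?_⟩, fun h => ?_⟩
  · have ham : a ≤ m :=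
      (h.total (Set.mem_insert_of_mem m ha) (Set.mem_insert m c)).resolve_right (hm a ha)
    exact ham.lt_of_not_ge (hm a ha)
  · exact h.1.insert fun a ha _ => Or.inr (h.2 a ha).le

open Classical in
theorem chainSum_insert [CommSemiring R] (y : α → R) {m : α} {S : Finset α}
    (hm : ∀ a ∈ S, ¬m ≤ a) :
    chainSum y (insert m S) = chainSum y S + y m * chainSum y {a ∈ S | a < m} := by
  have hmS : m ∉ S := fun h => hm m h le_rfl
  simp only [chainSum, sum_filter]
  rw [sum_powerset_insert hmS, ← sum_filter, ← sum_filter, ← sum_filter, mul_sum]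
  congr 1
  have hchains :
      S.powerset.filter (fun c => IsChain (· ≤ ·) ((insert m c : Finset α) : Set α)) =
        {a ∈ S | a < m}.powerset.filter (fun c : Finset α => IsChain (· ≤ ·) (c : Set α)) := by
    ext c
    simp only [mem_filter, mem_powerset, coe_insert, subset_iff]
    constructor
    · rintro ⟨hcS, hc⟩
      rw [isChain_insert_iff_of_not_le fun a ha => hm a (hcS ha)] at hc
      exact ⟨fun a ha => ⟨hcS ha, hc.2 a ha⟩, hc.1⟩
    · rintro ⟨hcS, hc⟩
      refine ⟨fun a ha => (hcS ha).1, ?_⟩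
      rw [isChain_insert_iff_of_not_le fun a ha => hm a (hcS ha).1]
      exact ⟨hc, fun a ha => (hcS ha).2⟩
  rw [hchains]
  refine sum_congr rfl fun c hc => prod_insert fun hmc => hmS ?_
  exact filter_subset _ _ (mem_powerset.1 (mem_filter.1 hc).1 hmc)

open Classical in
theorem chainSum_eq_one_add_sum [CommSemiring R] (y : α → R) (S : Finset α) :
    chainSum y S = 1 + ∑ t ∈ S, y t * chainSum y {a ∈ S | a < t} := by
  induction S using Finset.strongInduction with
  | H S ih =>
    obtain rfl | hne := S.eq_empty_or_nonempty
    · simp [chainSum, filter_singleton]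
    obtain ⟨m, hmS, hmax⟩ := S.exists_maximal hne
    have hnle : ∀ a ∈ S.erase m, ¬m ≤ a := fun a ha hma =>
      ne_of_mem_erase ha (hma.antisymm' (hmax (mem_of_mem_erase ha) hma))
    have hbelow : ∀ t ∈ S, {a ∈ S | a < t} = {a ∈ S.erase m | a < t} := fun t ht => by
      rw [filter_erase, erase_eq_of_notMem]
      exact fun h => (mem_filter.1 h).2.not_ge (hmax ht (mem_filter.1 h).2.le)
    rw [sum_congr rfl fun t ht => by rw [hbelow t ht], ← add_sum_erase _ _ hmS, add_left_comm,
      ← ih _ (erase_ssubset hmS), add_comm, ← chainSum_insert y hnle, insert_erase hmS]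

/-- The generating function of the order complex of the elements strictly below `t`; thus
`y t * chainSumBelow y t` counts the chains with largest element `t`. -/
noncomputable def chainSumBelow [CommSemiring R] [LocallyFiniteOrderBot α] (y : α → R) (t : α) :
    R :=
  chainSum y (Iio t)

theorem chainSum_eq_of_isLowerSet [CommSemiring R] [LocallyFiniteOrderBot α] (y : α → R)
    {S : Finset α} (hS : IsLowerSet (S : Set α)) :
    chainSum y S = 1 + ∑ t ∈ S, y t * chainSumBelow y t := by
  classical
  rw [chainSum_eq_one_add_sum]
  congr 1
  refine sum_congr rfl fun t ht => ?_
  have hIio : {a ∈ S | a < t} = Iio t := by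
    ext a
    rw [mem_filter, mem_Iio, and_iff_right_of_imp]
    exact fun hat => hS hat.le ht
  rw [hIio, chainSumBelow]

theorem chainSumBelow_eq [CommSemiring R] [LocallyFiniteOrderBot α] (y : α → R) (s : α) :
    chainSumBelow y s = 1 + ∑ t ∈ Iio s, y t * chainSumBelow y t :=
  chainSum_eq_of_isLowerSet y (by rw [coe_Iio]; exact isLowerSet_Iio s)

open Classical in
theorem sum_chainSumBelow_of_isLowerSet [CommSemiring R] [LocallyFiniteOrderBot α] (y : α → R)
    {S : Finset α} (hS : IsLowerSet (S : Set α)) :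
    ∑ t ∈ S, chainSumBelow y t =
      #S + ∑ r ∈ S, #{t ∈ S | r < t} * (y r * chainSumBelow y r) := by
  rw [sum_congr rfl fun t _ => chainSumBelow_eq y t, sum_add_distrib, sum_const, nsmul_one]
  congr 1
  rw [sum_comm' (t' := S) (s' := fun r => {t ∈ S | r < t})]
  · simp only [sum_const, nsmul_eq_mul]
  · intro t r
    simp only [mem_Iio, mem_filter]
    exact ⟨fun h => ⟨h, hS h.2.le h.1⟩, fun h => h.1⟩

variable [CommRing R] [CharP R 2] [LocallyFiniteOrder α] [LocallyFiniteOrderBot α]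

theorem sum_Iio_chainSumBelow_eq_zero
    (hIio : ∀ s : α, Even #(Iio s)) (hIoo : ∀ r s : α, r < s → Even #(Ioo r s))
    (y : α → R) (s : α) : ∑ t ∈ Iio s, chainSumBelow y t = 0 := by
  classical
  have cast_even : ∀ n : ℕ, Even n → (n : R) = 0 := fun n hn =>
    (CharP.cast_eq_zero_iff R 2 n).2 hn.two_dvd
  rw [sum_chainSumBelow_of_isLowerSet y (by rw [coe_Iio]; exact isLowerSet_Iio s),
    cast_even _ (hIio s), zero_add]
  refine sum_eq_zero fun r hr => ?_
  have hfilter : {t ∈ Iio s | r < t} = Ioo r s := by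
    ext t
    rw [mem_filter, mem_Iio, mem_Ioo, and_comm]
  rw [hfilter, cast_even _ (hIoo r s (mem_Iio.1 hr)), zero_mul]

theorem chainSumBelow_add_one
    (hIio : ∀ s : α, Even #(Iio s)) (hIoo : ∀ r s : α, r < s → Even #(Ioo r s))
    (y : α → R) (s : α) : chainSumBelow (y + 1) s = chainSumBelow y s := by
  induction hn : #(Iio s) using Nat.strong_induction_on generalizing s with
  | _ n ih =>
    have ih' : ∀ t ∈ Iio s, chainSumBelow (y + 1) t = chainSumBelow y t := fun t ht =>
      ih _ (hn ▸ card_lt_card (Iio_ssubset_Iio (mem_Iio.1 ht))) t rfl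
    calc chainSumBelow (y + 1) s
        = 1 + ∑ t ∈ Iio s, (y t * chainSumBelow y t + chainSumBelow y t) := by
          rw [chainSumBelow_eq]
          congr 1
          refine sum_congr rfl fun t ht => ?_
          rw [ih' t ht, Pi.add_apply, Pi.one_apply, add_one_mul]
      _ = chainSumBelow y s := by
          rw [sum_add_distrib, sum_Iio_chainSumBelow_eq_zero hIio hIoo, add_zero,
            ← chainSumBelow_eq]

theorem chainSum_univ_add_one_sub [Fintype α] [LocallyFiniteOrderTop α]
    (hIio : ∀ s : α, Even #(Iio s)) (hIoo : ∀ r s : α, r < s → Even #(Ioo r s)) (y : α → R) :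
    chainSum (y + 1) univ - chainSum y univ =
      Fintype.card α + ∑ r, #(Ioi r) * (y r * chainSumBelow y r) := by
  classical
  have huniv : IsLowerSet ((univ : Finset α) : Set α) := by
    rw [coe_univ]
    exact isLowerSet_univ
  have hsum : ∑ t, chainSumBelow y t =
      Fintype.card α + ∑ r, #(Ioi r) * (y r * chainSumBelow y r) := by
    rw [sum_chainSumBelow_of_isLowerSet y huniv, card_univ]
    simp only [filter_lt_eq_Ioi]
  rw [← hsum, chainSum_eq_of_isLowerSet _ huniv, chainSum_eq_of_isLowerSet _ huniv]
  simp only [chainSumBelow_add_one hIio hIoo, Pi.add_apply, Pi.one_apply, add_one_mul,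
    sum_add_distrib]
  ring

end ChainSums

/-! ### The parity of the number of down simplices -/

section DownCount

variable {Q : Type*} [Fintype Q] (K : AbstractSimplicialComplex Q)

open Classical in
/-- The number of simplices of `K` all of whose vertices are `↓`, modulo two: the exponent of the
sign of the GDS dual state. -/
noncomputable def downCount (x : Config Q) : ZMod 2 :=
  ∑ s : Finset Q with s ∈ K.faces, ∏ q ∈ s, x q

open Classical in
theorem downCount_sub_eq_sum_star [DecidableEq Q] {q : Q} {x y : Config Q}
    (hxy : ∀ p, p ≠ q → x p = y p) :
    downCount K x - downCount K y =
      ∑ s : Finset Q with s ∈ K.faces ∧ q ∈ s, (∏ p ∈ s, x p - ∏ p ∈ s, y p) := by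
  rw [downCount, downCount, ← sum_sub_distrib, ← filter_filter]
  refine (sum_filter_of_ne fun s _ hne => ?_).symm
  by_contra hq
  exact hne (sub_eq_zero.2 (prod_congr rfl fun p hp => hxy p (ne_of_mem_of_not_mem hp hq)))

end DownCount

section BarycentricSubdivision

variable {V : Type*} {L : AbstractSimplicialComplex V}

theorem Barycenter.nonempty (s : Barycenter L) : s.1.Nonempty :=
  (L.isRelLowerSet_faces s.2).1

section Intervals

variable [DecidableEq V] [DecidablePred (· ∈ L.faces)]

theorem even_card_Ioo_finset {r s : Finset V} (h : r ⊂ s) : Even #(Ioo r s) := by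
  obtain ⟨k, hk⟩ := Nat.exists_eq_add_of_lt (card_lt_card h)
  rw [card_Ioo_finset h.subset, hk, show #r + k + 1 - #r = k + 1 by omega, pow_succ,
    show 2 ^ k * 2 - 2 = 2 * (2 ^ k - 1) by omega]
  exact even_two_mul _

theorem map_subtype_Ioo (r s : Barycenter L) :
    (Ioo r s).map (Function.Embedding.subtype (· ∈ L.faces)) = Ioo r.1 s.1 :=
  map_subtype_embedding_Ioo _ r s fun _ _ _ hrt hts hr hs =>
    (L.isRelLowerSet_faces hs).2 hts ((L.isRelLowerSet_faces hr).1.mono hrt)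

theorem map_subtype_Iio (s : Barycenter L) :
    (Iio s).map (Function.Embedding.subtype (· ∈ L.faces)) = Ioo ∅ s.1 := by
  rw [subtype_Iio_eq, subtype_map]
  ext t
  simp only [mem_filter, mem_Iio, mem_Ioo, empty_ssubset, and_comm (a := t ⊂ s.1)]
  refine and_congr_left fun hts => ⟨fun ht => (L.isRelLowerSet_faces ht).1, fun hne => ?_⟩
  exact (L.isRelLowerSet_faces s.2).2 hts.subset hne

theorem even_card_Iio_barycenter (s : Barycenter L) : Even #(Iio s) := by
  rw [← card_map (Function.Embedding.subtype (· ∈ L.faces)), map_subtype_Iio]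
  exact even_card_Ioo_finset (empty_ssubset.2 s.nonempty)

theorem even_card_Ioo_barycenter {r s : Barycenter L} (h : r < s) : Even #(Ioo r s) := by
  rw [← card_map (Function.Embedding.subtype (· ∈ L.faces)), map_subtype_Ioo]
  exact even_card_Ioo_finset h

theorem chainSumBelow_of_card_eq_one {R : Type*} [CommSemiring R] (y : Barycenter L → R)
    {s : Barycenter L} (hs : #s.1 = 1) : chainSumBelow y s = 1 := by
  have hIio : Iio s = ∅ := by
    refine eq_empty_of_forall_notMem fun t ht => ?_
    have hts : t.1 ⊂ s.1 := show t < s from mem_Iio.1 ht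
    have := card_lt_card hts
    have := t.nonempty.card_pos
    omega
  rw [chainSumBelow_eq, hIio, sum_empty, add_zero]

theorem mul_sum_ssubsets_prod {s : Finset V} {v : V} (hv : v ∈ s) (z : V → ZMod 2) :
    z v * ∑ t ∈ s.ssubsets, ∏ w ∈ t, z w = ∏ w ∈ s, z w := by
  have hmul : ∀ a : ZMod 2, a * (1 + a) = 0 ∧ a * a = a := by decide
  have hsum : ∑ t ∈ s.ssubsets, ∏ w ∈ t, z w = ∏ w ∈ s, (1 + z w) - ∏ w ∈ s, z w := by
    rw [prod_one_add, ← sum_erase_add _ _ (mem_powerset_self s), add_sub_cancel_right, ssubsets]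
  rw [hsum, CharTwo.sub_eq_add, mul_add, ← mul_prod_erase _ _ hv, ← mul_prod_erase _ _ hv,
    ← mul_assoc, ← mul_assoc, (hmul _).1, (hmul _).2, zero_mul, zero_add]

theorem mul_chainSumBelow_comp {v : Barycenter L → V} (hv : ∀ s, v s ∈ s.1) (z : Config V)
    (s : Barycenter L) :
    z (v s) * chainSumBelow (z ∘ v) s = ∏ w ∈ s.1, z w := by
  induction s using WellFoundedLT.induction with
  | ind s ih =>
    have ih' : ∀ t ∈ Iio s, (z ∘ v) t * chainSumBelow (z ∘ v) t = ∏ w ∈ t.1, z w :=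
      fun t ht => ih t (mem_Iio.1 ht)
    have hsum : chainSumBelow (z ∘ v) s = ∑ t ∈ s.1.ssubsets, ∏ w ∈ t, z w := by
      rw [chainSumBelow_eq, sum_congr rfl ih',
        ← Iio_eq_ssubsets, ← Ico_bot, bot_eq_empty,
        ← Ioo_insert_left (empty_ssubset.2 s.nonempty), sum_insert left_notMem_Ioo, prod_empty,
        ← map_subtype_Iio, sum_map]
      rfl
    rw [hsum, mul_sum_ssubsets_prod (hv s)]

end Intervals

variable [Fintype V]

theorem one_add_downCount_barycentricSubdivision (y : Config (Barycenter L)) :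
    1 + downCount (barycentricSubdivision L) y = chainSum y univ := by
  classical
  have hempty : (∅ : Finset (Barycenter L)) ∈ univ.powerset.filter
      (fun c : Finset (Barycenter L) => IsChain (· ≤ ·) (c : Set (Barycenter L))) := by
    simp
  rw [chainSum, ← add_sum_erase _ _ hempty, prod_empty, downCount]
  congr 1
  refine sum_congr ?_ fun _ _ => rfl
  ext c
  simp only [mem_filter, mem_erase, mem_powerset, subset_univ, mem_univ, true_and,
    ← nonempty_iff_ne_empty]
  rfl

theorem downCount_barycentricSubdivision_comp {v : Barycenter L → V} (hv : ∀ s, v s ∈ s.1)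
    (z : Config V) :
    downCount (barycentricSubdivision L) (z ∘ v) = downCount L z := by
  classical
  rw [← add_right_inj 1, one_add_downCount_barycentricSubdivision,
    chainSum_eq_of_isLowerSet _ (by rw [coe_univ]; exact isLowerSet_univ)]
  simp only [Function.comp_apply, mul_chainSumBelow_comp hv, downCount]
  congr 1
  exact (sum_subtype _ (fun s => by simp) (fun s => ∏ w ∈ s, z w)).symm

theorem intCast_eulerChar {R : Type*} [Ring R] [CharP R 2] (K : PreAbstractSimplicialComplex V)
    [DecidablePred (· ∈ K.faces)] :
    (eulerChar K : R) = #{t : Finset V | t ∈ K.faces} := by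
  simp only [eulerChar, Int.cast_sum, Int.cast_pow, Int.cast_neg, Int.cast_one, CharTwo.neg_eq,
    one_pow, sum_const, nsmul_one]
  congr!

variable [DecidableEq V]

section UpperIntervals

variable [DecidablePred (· ∈ L.faces)]

theorem card_Ioi_barycenter (s : Barycenter L) [DecidablePred (· ∈ (link L s.1).faces)] :
    #(Ioi s) = #{t : Finset V | t ∈ (link L s.1).faces} := by
  refine card_bij (fun t _ => t.1 \ s.1) ?_ ?_ ?_
  · intro t ht
    have hst : s.1 ⊂ t.1 := show s < t from mem_Ioi.1 ht
    refine mem_filter.2 ⟨mem_univ _, ?_, sdiff_disjoint, ?_⟩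
    · exact (L.isRelLowerSet_faces t.2).2 sdiff_subset (sdiff_nonempty.2 hst.2)
    · rw [sdiff_union_of_subset hst.1]
      exact t.2
  · intro t ht t' ht' h
    have hst : s.1 ⊂ t.1 := show s < t from mem_Ioi.1 ht
    have hst' : s.1 ⊂ t'.1 := show s < t' from mem_Ioi.1 ht'
    apply Subtype.ext
    rw [← sdiff_union_of_subset hst.1, h, sdiff_union_of_subset hst'.1]
  · intro t ht
    obtain ⟨htL, hdisj, hunion⟩ := (mem_filter.1 ht).2
    refine ⟨⟨t ∪ s.1, hunion⟩, mem_Ioi.2 ?_, union_sdiff_cancel_right hdisj⟩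
    refine (subset_union_right : s.1 ⊆ t ∪ s.1).ssubset_of_not_subset fun h => ?_
    have hts : t ⊆ s.1 := subset_union_left.trans h
    exact (L.isRelLowerSet_faces htL).1.ne_empty (disjoint_self.1 (hdisj.mono_right hts))

theorem natCast_card_Ioi_barycenter {R : Type*} [Ring R] [CharP R 2] (s : Barycenter L) :
    (#(Ioi s) : R) = eulerChar (link L s.1) := by
  classical
  rw [card_Ioi_barycenter, intCast_eulerChar]

theorem downCount_barycentricSubdivision_add_one_sub (x : Config (Barycenter L)) :
    downCount (barycentricSubdivision L) (x + 1) - downCount (barycentricSubdivision L) x =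
      Fintype.card (Barycenter L) +
        ∑ s : Barycenter L, #(Ioi s) * (x s * chainSumBelow x s) := by
  have h := chainSum_univ_add_one_sub (R := ZMod 2) (α := Barycenter L)
    even_card_Iio_barycenter (fun _ _ => even_card_Ioo_barycenter) x
  rw [← h, ← one_add_downCount_barycentricSubdivision, ← one_add_downCount_barycentricSubdivision]
  ring

end UpperIntervals

/-- A chain with largest simplex `s` contributes once for every simplex above `s`, hence an even
number of times unless `s` is a vertex. -/
theorem dependsOn_downCount_add_one_sub
    (hL : ∀ s ∈ L.faces, 2 ≤ #s → Even (eulerChar (link L s))) :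
    DependsOn (fun x : Config (Barycenter L) => downCount (barycentricSubdivision L) (x + 1) -
      downCount (barycentricSubdivision L) x) {s | #s.1 = 1} := by
  classical
  intro x y hxy
  simp only [downCount_barycentricSubdivision_add_one_sub]
  refine congrArg _ (sum_congr rfl fun s _ => ?_)
  by_cases hs : #s.1 = 1
  · rw [chainSumBelow_of_card_eq_one x hs, chainSumBelow_of_card_eq_one y hs, hxy s hs]
  · have hs' : 2 ≤ #s.1 := by
      have := s.nonempty.card_pos
      omega
    rw [natCast_card_Ioi_barycenter, ZMod.intCast_eq_zero_iff_even.2 (hL s.1 s.2 hs'), zero_mul,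
      zero_mul]

end BarycentricSubdivision

/-! ### Diagonal sign gates -/

section Sign

/-- The sign `(-1) ^ a`, as an additive character. -/
noncomputable def sgn : AddChar (ZMod 2) ℂ := AddChar.zmodChar 2 (neg_one_sq : (-1 : ℂ) ^ 2 = 1)

theorem zmod_two_eq_zero_or_eq_one : ∀ a : ZMod 2, a = 0 ∨ a = 1 := by
  decide

theorem sgn_apply (a : ZMod 2) : sgn a = if a = 1 then -1 else 1 := by
  rcases zmod_two_eq_zero_or_eq_one a with rfl | rfl
  · rw [AddChar.map_zero_eq_one, if_neg zero_ne_one]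
  · rw [sgn, AddChar.zmodChar_apply, ZMod.val_one, pow_one, if_pos rfl]

theorem sgn_sum {ι : Type*} (s : Finset ι) (f : ι → ZMod 2) :
    sgn (∑ i ∈ s, f i) = ∏ i ∈ s, sgn (f i) :=
  map_prod sgn.toMonoidHom (fun i => Multiplicative.ofAdd (f i)) s

theorem sgn_mul_self (a : ZMod 2) : sgn a * sgn a = 1 := by
  rw [← AddChar.map_add_eq_mul, CharTwo.add_self_eq_zero, AddChar.map_zero_eq_one]

theorem conj_sgn (a : ZMod 2) : starRingEnd ℂ (sgn a) = sgn a := by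
  rw [sgn_apply, apply_ite (starRingEnd ℂ), map_neg, map_one]

theorem prod_zmod_two_eq_one_iff {ι : Type*} {s : Finset ι} {x : ι → ZMod 2} :
    ∏ i ∈ s, x i = 1 ↔ ∀ i ∈ s, x i = 1 := by
  have hne : ∀ a : ZMod 2, a = 1 ↔ a ≠ 0 := by decide
  simp only [hne, prod_ne_zero_iff]

variable {Q : Type*} [Fintype Q] [DecidableEq Q]

theorem gdsDualState_apply (K : AbstractSimplicialComplex Q) (x : Config Q) :
    gdsDualState K x = sgn (downCount K x) * plusState Q x := by
  rw [gdsDualState, disentangler, Matrix.mulVec_diagonal, downCount, sgn_sum]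
  congr 1
  refine prod_congr rfl fun s _ => ?_
  rw [ckZ, Matrix.diagonal_apply_eq, sgn_apply]
  exact if_congr prod_zmod_two_eq_one_iff.symm rfl rfl

/-- The diagonal gate with entries `(-1) ^ T x`. -/
noncomputable def signGate (S : Finset Q) (T : Config Q → ZMod 2) (hT : DependsOn T (S : Set Q)) :
    Gate Q where
  support := S
  op := Matrix.diagonal fun x => sgn (T x)
  unitary := by
    simp [Matrix.mem_unitaryGroup_iff, Matrix.star_eq_conjTranspose, Matrix.diagonal_conjTranspose,
      Matrix.diagonal_mul_diagonal, ← starRingEnd_apply, conj_sgn, sgn_mul_self]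
  supported := by
    obtain ⟨t, rfl⟩ := dependsOn_iff_exists_comp.1 hT
    refine ⟨Matrix.diagonal fun a => sgn (t a), fun x y => ?_⟩
    have hxy : x = y ↔ (∀ q, q ∉ S → x q = y q) ∧ (fun q : S => x q) = fun q : S => y q := by
      simp only [funext_iff, Subtype.forall, ← forall_and]
      exact forall_congr' fun q => by tauto
    simp only [Matrix.diagonal_apply, hxy, ite_and]
    rfl

theorem signGate_isSymmetric {S : Finset Q} {T : Config Q → ZMod 2}
    (hT : DependsOn T (S : Set Q)) (hflip : ∀ x, T (x + 1) = T x) :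
    (signGate S T hT).IsSymmetric := by
  rintro ⟨a, b⟩ ψ
  have hshift : ∀ x : Config Q, T (fun q => x q - a) = T x := by
    intro x
    rcases zmod_two_eq_zero_or_eq_one a with rfl | rfl
    · simp only [sub_zero]
    · rw [← hflip fun q => x q - 1]
      exact congrArg T (sub_add_cancel x 1)
  funext x
  simp only [signGate, Matrix.mulVec_diagonal, symmetryAction, hshift]
  split_ifs
  · rfl
  · rw [map_mul, conj_sgn]

end Sign

section Circuits

variable {Q ι : Type*}

theorem colorable_of_forall_degree_lt {n : ℕ} [Fintype ι] {G : SimpleGraph ι} [DecidableRel G.Adj]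
    (hG : ∀ i, G.degree i < n) : G.Colorable n := by
  classical
  suffices h : ∀ A : Finset ι, ∃ C : ι → Fin n, ∀ i ∈ A, ∀ j ∈ A, G.Adj i j → C i ≠ C j by
    obtain ⟨C, hC⟩ := h univ
    exact ⟨SimpleGraph.Coloring.mk C fun {i j} => hC i (mem_univ i) j (mem_univ j)⟩
  intro A
  induction A using Finset.induction_on with
  | empty => exact ⟨fun i => ⟨_, hG i⟩, by simp⟩
  | insert a A ha ih =>
    obtain ⟨C, hC⟩ := ih
    obtain ⟨k, -, hk⟩ := exists_mem_notMem_of_card_lt_card (s := (G.neighborFinset a).image C)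
      (t := univ) (card_image_le.trans_lt (by simpa using hG a))
    have hfree : ∀ j ∈ A, G.Adj a j → k ≠ C j := by
      rintro j - haj rfl
      exact hk (mem_image_of_mem C ((G.mem_neighborFinset a j).2 haj))
    have hne : ∀ j ∈ A, j ≠ a := fun j hj => ne_of_mem_of_not_mem hj ha
    refine ⟨Function.update C a k, ?_⟩
    simp only [forall_mem_insert, Function.update_self]
    refine ⟨⟨fun h => (G.loopless.irrefl a h).elim, fun j hj haj => ?_⟩,
      fun i hi => ⟨fun hia => ?_, fun j hj => ?_⟩⟩
    · rw [Function.update_of_ne (hne j hj)]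
      exact hfree j hj haj
    · rw [Function.update_of_ne (hne i hi)]
      exact (hfree i hi hia.symm).symm
    · rw [Function.update_of_ne (hne i hi), Function.update_of_ne (hne j hj)]
      exact hC i hi j hj

/-- The intersection graph of a family of sets: gates can be put into the same layer if they are
not adjacent in the intersection graph of their supports. -/
def intersectionGraph (S : ι → Finset Q) : SimpleGraph ι where
  Adj i j := i ≠ j ∧ ¬Disjoint (S i) (S j)
  symm := ⟨fun _ _ h => ⟨h.1.symm, fun hd => h.2 hd.symm⟩⟩
  loopless := ⟨fun _ h => h.1 rfl⟩

variable [Fintype Q] [DecidableEq Q]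

theorem foldl_map_signGate_apply {S : ι → Finset Q} {T : ι → Config Q → ZMod 2}
    (hT : ∀ i, DependsOn (T i) (S i : Set Q)) (l : List ι) (ψ : State Q) (x : Config Q) :
    (l.map fun i => signGate (S i) (T i) (hT i)).foldl (fun χ g => g.op.mulVec χ) ψ x =
      sgn (l.map fun i => T i x).sum * ψ x := by
  induction l generalizing ψ with
  | nil => simp
  | cons i l ih =>
    rw [List.map_cons, List.foldl_cons, ih, List.map_cons, List.sum_cons, AddChar.map_add_eq_mul,
      signGate, Matrix.mulVec_diagonal]
    ring

variable [Fintype ι]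

/-- The circuit of a family of sign gates whose `k`-th layer consists of the gates of colour `k`. -/
noncomputable def signCircuit {S : ι → Finset Q} {T : ι → Config Q → ZMod 2}
    (hT : ∀ i, DependsOn (T i) (S i : Set Q)) {n : ℕ} (C : (intersectionGraph S).Coloring (Fin n)) :
    Circuit Q where
  layers := (List.finRange n).map fun k =>
    (univ.filter fun i => C i = k).toList.map fun i => signGate (S i) (T i) (hT i)
  disjoint := by
    intro l hl
    obtain ⟨k, -, rfl⟩ := List.mem_map.1 hl
    rw [List.pairwise_map]
    refine (nodup_toList _).pairwise_of_forall_ne fun i hi j hj hij => ?_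
    rw [mem_toList, mem_filter] at hi hj
    by_contra hd
    exact C.valid ⟨hij, hd⟩ (hi.2.trans hj.2.symm)

section SignCircuit

variable {S : ι → Finset Q} {T : ι → Config Q → ZMod 2} (hT : ∀ i, DependsOn (T i) (S i : Set Q))
  {n : ℕ} (C : (intersectionGraph S).Coloring (Fin n))

theorem depth_signCircuit : (signCircuit hT C).depth = n := by
  rw [Circuit.depth, signCircuit, List.length_map, List.length_finRange]

theorem exists_eq_signGate_of_mem_layers {l : List (Gate Q)} {g : Gate Q}
    (hl : l ∈ (signCircuit hT C).layers) (hg : g ∈ l) : ∃ i, g = signGate (S i) (T i) (hT i) := by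
  obtain ⟨k, -, rfl⟩ := List.mem_map.1 hl
  obtain ⟨i, -, rfl⟩ := List.mem_map.1 hg
  exact ⟨i, rfl⟩

theorem apply_signCircuit (ψ : State Q) (x : Config Q) :
    (signCircuit hT C).apply ψ x = sgn (∑ i, T i x) * ψ x := by
  have hflatten : (signCircuit hT C).layers.flatten =
      ((List.finRange n).flatMap fun k => (univ.filter fun i => C i = k).toList).map
        fun i => signGate (S i) (T i) (hT i) := by
    rw [signCircuit, ← List.flatMap_def, List.map_flatMap]
  rw [Circuit.apply, ← List.foldl_flatten, hflatten, foldl_map_signGate_apply,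
    List.map_flatMap, List.flatMap_def, List.sum_flatten, List.map_map, ← Fin.sum_univ_def]
  simp only [Function.comp_apply, sum_map_toList, sum_fiberwise]

end SignCircuit

end Circuits

/-! ### Replacing spins one at a time -/

section ClosedBall

variable {Q : Type*} [Fintype Q] (G : SimpleGraph Q)

open Classical in
/-- The finite set of vertices at distance at most `r` from `q`. -/
noncomputable def closedBall (q : Q) (r : ℕ) : Finset Q := {p | G.edist q p ≤ r}

variable {G}

theorem mem_closedBall {p q : Q} {r : ℕ} : p ∈ closedBall G q r ↔ G.edist q p ≤ r := by
  rw [closedBall, mem_filter, and_iff_right (mem_univ p)]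

theorem mem_closedBall_self (q : Q) (r : ℕ) : q ∈ closedBall G q r := by
  rw [mem_closedBall, SimpleGraph.edist_self]
  exact zero_le

theorem mem_closedBall_comm {p q : Q} {r : ℕ} : p ∈ closedBall G q r ↔ q ∈ closedBall G p r := by
  rw [mem_closedBall, mem_closedBall, SimpleGraph.edist_comm]

theorem mem_closedBall_add {m p q : Q} {r s : ℕ} (hp : p ∈ closedBall G q r)
    (hm : m ∈ closedBall G p s) : m ∈ closedBall G q (r + s) := by
  rw [mem_closedBall] at hp hm ⊢
  rw [Nat.cast_add]
  exact SimpleGraph.edist_triangle.trans (add_le_add hp hm)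

theorem closedBall_zero (q : Q) : closedBall G q 0 = {q} := by
  ext p
  rw [mem_closedBall, Nat.cast_zero, nonpos_iff_eq_zero, SimpleGraph.edist_eq_zero_iff,
    mem_singleton, eq_comm]

theorem exists_mem_closedBall_one_of_mem_closedBall_succ {p q : Q} {r : ℕ}
    (hp : p ∈ closedBall G q (r + 1)) : ∃ m ∈ closedBall G q 1, p ∈ closedBall G m r := by
  simp only [mem_closedBall] at hp ⊢
  obtain ⟨w, hw⟩ := SimpleGraph.exists_walk_of_edist_ne_top
    (ne_top_of_le_ne_top (ENat.natCast_ne_top _) hp)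
  rw [← hw, Nat.cast_le] at hp
  cases w with
  | nil => exact ⟨p, by simp, by simp⟩
  | @cons _ m _ h w =>
    refine ⟨m, (SimpleGraph.edist_eq_one_iff_adj.2 h).le, w.edist_le.trans ?_⟩
    exact Nat.cast_le.2 (Nat.le_of_succ_le_succ hp)

theorem card_closedBall_le_pow {D : ℕ} (hD : ∀ q, #(closedBall G q 1) ≤ D) (q : Q) (r : ℕ) :
    #(closedBall G q r) ≤ D ^ r := by
  classical
  induction r generalizing q with
  | zero => rw [closedBall_zero, card_singleton, pow_zero]
  | succ r ih =>
    have hsub : closedBall G q (r + 1) ⊆ (closedBall G q 1).biUnion fun m => closedBall G m r :=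
      fun p hp => mem_biUnion.2 (exists_mem_closedBall_one_of_mem_closedBall_succ hp)
    calc #(closedBall G q (r + 1))
        ≤ #(closedBall G q 1) * D ^ r :=
          (card_le_card hsub).trans (card_biUnion_le_card_mul _ _ _ fun m _ => ih m)
      _ ≤ D ^ (r + 1) := by
          rw [pow_succ']
          exact Nat.mul_le_mul_right _ (hD q)

open Classical in
theorem degree_intersectionGraph_closedBall_le (q : Q) (r : ℕ) :
    (intersectionGraph fun p => closedBall G p r).degree q ≤ #(closedBall G q (r + r)) := by
  rw [← SimpleGraph.card_neighborFinset_eq_degree]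
  refine card_le_card fun p hp => ?_
  obtain ⟨m, hmq, hmp⟩ := not_disjoint_iff.1 ((SimpleGraph.mem_neighborFinset _ _ _).1 hp).2
  exact mem_closedBall_add hmq (mem_closedBall_comm.1 hmp)

end ClosedBall

section PartialPullback

variable {Q : Type*} [DecidableEq Q] {π : Q → Q}

/-- The configuration `x` with the spin at each site `q ∈ A` replaced by the spin at `π q`. -/
def partialPullback (π : Q → Q) (A : Finset Q) (x : Config Q) : Config Q :=
  A.piecewise (x ∘ π) x

theorem partialPullback_add_one (A : Finset Q) (x : Config Q) :
    partialPullback π A (x + 1) = partialPullback π A x + 1 := by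
  ext q
  by_cases hq : q ∈ A <;> simp [partialPullback, hq]

theorem partialPullback_of_fixed (A : Finset Q) (x : Config Q) {q : Q} (hq : π q = q) :
    partialPullback π A x q = x q := by
  by_cases hqA : q ∈ A <;> simp [partialPullback, hqA, hq]

theorem dependsOn_partialPullback_apply (A : Finset Q) (q : Q) :
    DependsOn (fun x => partialPullback π A x q) {q, π q} := by
  intro x y hxy
  by_cases hq : q ∈ A
  · simpa [partialPullback, hq] using hxy (π q) (by simp)
  · simpa [partialPullback, hq] using hxy q (by simp)

/-- Enlarge `∅` to `S` one element at a time; `A q` is the set to which `q` is added. -/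
theorem exists_sum_sub_insert_eq {M : Type*} [AddCommGroup M] (f : Finset Q → M) (S : Finset Q) :
    ∃ A : Q → Finset Q, ∑ q ∈ S, (f (A q) - f (insert q (A q))) = f ∅ - f S := by
  induction S using Finset.induction_on with
  | empty => exact ⟨fun _ => ∅, by rw [sum_empty, sub_self]⟩
  | insert p S hp ih =>
    obtain ⟨A, hA⟩ := ih
    refine ⟨Function.update A p S, ?_⟩
    rw [sum_insert hp, Function.update_self]
    have hS : ∀ q ∈ S, Function.update A p S q = A q := fun q hq =>
      Function.update_of_ne (ne_of_mem_of_not_mem hq hp) _ _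
    rw [sum_congr rfl fun q hq => by rw [hS q hq], hA]
    abel

variable [Fintype Q] (K : AbstractSimplicialComplex Q)

/-- The change of the number of down simplices, modulo two, when the spin at `q` is replaced by the
spin at `π q` after the spins in `A` have been replaced. -/
noncomputable def pullbackStep (π : Q → Q) (A : Finset Q) (q : Q) (x : Config Q) : ZMod 2 :=
  downCount K (partialPullback π A x) - downCount K (partialPullback π (insert q A) x)

variable {K}

theorem mem_closedBall_one_of_mem_face {s : Finset Q} (hs : s ∈ K.faces) {p q : Q} (hp : p ∈ s)
    (hq : q ∈ s) : p ∈ closedBall (oneSkeleton K) q 1 := by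
  rw [mem_closedBall, Nat.cast_one, SimpleGraph.edist_le_one_iff_adj_or_eq]
  rcases eq_or_ne q p with hqp | hqp
  · exact Or.inr hqp
  · refine Or.inl ⟨hqp, (K.isRelLowerSet_faces hs).2 ?_ (insert_nonempty q {p})⟩
    exact insert_subset hq (singleton_subset_iff.2 hp)

theorem dependsOn_pullbackStep (hπ : ∀ q, π q ∈ closedBall (oneSkeleton K) q 1) (A : Finset Q)
    (q : Q) :
    DependsOn (pullbackStep K π A q) (closedBall (oneSkeleton K) q 2 : Set Q) := by
  classical
  intro x y hxy
  have hstar : ∀ z : Config Q, ∀ p, p ≠ q →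
      partialPullback π A z p = partialPullback π (insert q A) z p := fun z p hp =>
    (piecewise_insert_of_ne _ _ _ hp).symm
  have hlocal : ∀ B : Finset Q, ∀ s ∈ K.faces, q ∈ s → ∀ p ∈ s,
      partialPullback π B x p = partialPullback π B y p := by
    intro B s hs hq p hp
    have hpq : p ∈ closedBall (oneSkeleton K) q 1 := mem_closedBall_one_of_mem_face hs hp hq
    refine dependsOn_partialPullback_apply B p ?_
    rintro _ (rfl | rfl)
    · exact hxy _ (mem_closedBall_add hpq (mem_closedBall_self _ 1))
    · exact hxy _ (mem_closedBall_add hpq (hπ p))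
  rw [pullbackStep, pullbackStep, downCount_sub_eq_sum_star K (hstar x),
    downCount_sub_eq_sum_star K (hstar y)]
  refine sum_congr rfl fun s hs => ?_
  obtain ⟨hsK, hqs⟩ := (mem_filter.1 hs).2
  rw [prod_congr rfl (hlocal A s hsK hqs), prod_congr rfl (hlocal (insert q A) s hsK hqs)]

theorem pullbackStep_add_one
    (hflip : DependsOn (fun x => downCount K (x + 1) - downCount K x) {q | π q = q})
    (A : Finset Q) (q : Q) (x : Config Q) :
    pullbackStep K π A q (x + 1) = pullbackStep K π A q x := by
  have h := @hflip (partialPullback π A x) (partialPullback π (insert q A) x) fun p hp => by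
    rw [partialPullback_of_fixed A x hp, partialPullback_of_fixed (insert q A) x hp]
  rw [pullbackStep, pullbackStep, partialPullback_add_one, partialPullback_add_one]
  linear_combination h

/-- The sign telescopes into the signs of the steps that replace the spins one at a time, and a
greedy colouring distributes the gates of these steps over the layers. -/
theorem exists_symmetric_circuit_apply_eq_sgn_sub_comp {D : ℕ}
    (hD : ∀ q, #(closedBall (oneSkeleton K) q 1) ≤ D)
    (hπ : ∀ q, π q ∈ closedBall (oneSkeleton K) q 1)
    (hflip : DependsOn (fun x => downCount K (x + 1) - downCount K x) {q | π q = q}) :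
    ∃ c : Circuit Q, c.IsLocallySymmetric ∧ c.HasRange K 4 ∧ c.depth = D ^ 4 + 1 ∧
      ∀ ψ x, c.apply ψ x = sgn (downCount K x - downCount K (x ∘ π)) * ψ x := by
  classical
  obtain ⟨A, hA⟩ :=
    exists_sum_sub_insert_eq (fun A x => downCount K (partialPullback π A x)) univ
  have hT : ∀ q, DependsOn (pullbackStep K π (A q) q) (closedBall (oneSkeleton K) q 2 : Set Q) :=
    fun q => dependsOn_pullbackStep hπ (A q) q
  obtain ⟨C⟩ : (intersectionGraph fun q => closedBall (oneSkeleton K) q 2).Colorable (D ^ 4 + 1) :=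
    colorable_of_forall_degree_lt fun q => Nat.lt_succ_of_le <|
      (degree_intersectionGraph_closedBall_le q 2).trans (card_closedBall_le_pow hD q 4)
  refine ⟨signCircuit hT C, fun l hl g hg => ?_, fun l hl g hg p hp q hq => ?_,
    depth_signCircuit hT C, fun ψ x => ?_⟩
  · obtain ⟨q, rfl⟩ := exists_eq_signGate_of_mem_layers hT C hl hg
    exact signGate_isSymmetric (hT q) (pullbackStep_add_one hflip (A q) q)
  · obtain ⟨m, rfl⟩ := exists_eq_signGate_of_mem_layers hT C hl hg
    exact mem_closedBall.1 (mem_closedBall_add (mem_closedBall_comm.1 hp) hq)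
  · have hsum : ∑ q, pullbackStep K π (A q) q x = downCount K x - downCount K (x ∘ π) := by
      simpa [pullbackStep, partialPullback] using congrFun hA x
    rw [apply_signCircuit, hsum]

end PartialPullback

/-! ### The circuit on the barycentric subdivision -/

section VertexSpins

variable {V : Type*} {L : AbstractSimplicialComplex V}

variable (L) in
/-- The vertex `v` of `L` as a vertex of the barycentric subdivision. -/
def vertexBarycenter (v : V) : Barycenter L := ⟨{v}, L.singleton_mem v⟩

/-- An arbitrary vertex of the simplex `s`, from which the barycenter of `s` takes its spin. -/
noncomputable def someVertex (s : Barycenter L) : V := s.nonempty.choose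

theorem someVertex_mem (s : Barycenter L) : someVertex s ∈ s.1 := s.nonempty.choose_spec

theorem vertexBarycenter_someVertex_le (s : Barycenter L) :
    vertexBarycenter L (someVertex s) ≤ s :=
  singleton_subset_iff.2 (someVertex_mem s)

theorem vertexBarycenter_someVertex_eq {s : Barycenter L} (hs : #s.1 = 1) :
    vertexBarycenter L (someVertex s) = s :=
  Subtype.ext <| eq_of_subset_of_card_le (vertexBarycenter_someVertex_le s) <|
    hs.trans_le (card_singleton _).ge

theorem card_le_of_vertexBound [Finite V] {R : ℕ} (hR : VertexBound L R) (s : Barycenter L) :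
    #s.1 ≤ R := by
  classical
  obtain ⟨v, hv⟩ := s.nonempty
  refine le_trans ?_ (hR v)
  rw [← Set.ncard_coe_finset]
  refine Set.ncard_le_ncard_of_injOn (fun w => ({v, w} : Finset V)) (fun w hw => ?_)
    (fun w _ w' _ h => ?_) (Set.toFinite _)
  · exact ⟨(L.isRelLowerSet_faces s.2).2 (insert_subset hv (singleton_subset_iff.2 hw))
      (insert_nonempty v {w}), mem_insert_self v {w}⟩
  · have hpair : ({v, w} : Set V) = {v, w'} := by
      simpa only [coe_pair] using congrArg (fun t : Finset V => (t : Set V)) h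
    rcases Set.pair_eq_pair_iff.1 hpair with ⟨-, hww'⟩ | ⟨hvw', hwv⟩
    · exact hww'
    · exact hwv.trans hvw'

variable [Fintype V] [DecidableEq V]

theorem mem_closedBall_one_barycentricSubdivision {s t : Barycenter L} :
    t ∈ closedBall (oneSkeleton (barycentricSubdivision L)) s 1 ↔ t ≤ s ∨ s ≤ t := by
  have hchain (h : t ≤ s ∨ s ≤ t) : {s, t} ∈ (barycentricSubdivision L).faces := by
    refine ⟨insert_nonempty s {t}, ?_⟩
    rw [coe_pair]
    refine IsChain.singleton.insert ?_
    rintro _ rfl -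
    exact h.symm
  refine ⟨fun ht => ?_, fun h => mem_closedBall_one_of_mem_face (hchain h) (by simp) (by simp)⟩
  rw [mem_closedBall, Nat.cast_one, SimpleGraph.edist_le_one_iff_adj_or_eq] at ht
  rcases ht with ⟨-, hst⟩ | rfl
  · exact hst.2.total (by simp) (by simp)
  · exact Or.inl le_rfl

theorem card_barycenter_mem_le {R : ℕ} (hR : VertexBound L R) (v : V) :
    #{t : Barycenter L | v ∈ t.1} ≤ R := by
  refine le_trans ?_ (hR v)
  rw [← Set.ncard_coe_finset]
  exact Set.ncard_le_ncard_of_injOn Subtype.val (fun t ht => ⟨t.2, (mem_filter.1 ht).2⟩)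
    Subtype.val_injective.injOn (Set.toFinite _)

theorem card_closedBall_one_barycentricSubdivision_le {R : ℕ} (hR : VertexBound L R)
    (s : Barycenter L) :
    #(closedBall (oneSkeleton (barycentricSubdivision L)) s 1) ≤ R ^ 2 := by
  have hsub : closedBall (oneSkeleton (barycentricSubdivision L)) s 1 ⊆
      s.1.biUnion fun v => {t : Barycenter L | v ∈ t.1} := by
    intro t ht
    simp only [mem_biUnion, mem_filter, mem_univ, true_and]
    rcases mem_closedBall_one_barycentricSubdivision.1 ht with hts | hst
    · obtain ⟨v, hv⟩ := t.nonempty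
      exact ⟨v, hts hv, hv⟩
    · obtain ⟨v, hv⟩ := s.nonempty
      exact ⟨v, hv, hst hv⟩
  calc #(closedBall (oneSkeleton (barycentricSubdivision L)) s 1)
      ≤ #s.1 * R := (card_le_card hsub).trans <|
        card_biUnion_le_card_mul _ _ _ fun v _ => card_barycenter_mem_le hR v
    _ ≤ R ^ 2 := by
        rw [sq]
        exact Nat.mul_le_mul_right R (card_le_of_vertexBound hR s)

theorem plusState_mul_plusState_vertexSplit (x : Config (Barycenter L)) :
    plusState V (x ∘ vertexBarycenter L) *
        plusState (NewVertex L) (fun b => x (vertexSplit L (Sum.inr b))) =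
      plusState (Barycenter L) x := by
  rw [plusState, plusState, plusState, ← (vertexSplit L).prod_comp, Fintype.prod_sum_type]
  rfl

theorem tensorState_vertexSplit_apply (x : Config (Barycenter L)) :
    tensorState (vertexSplit L) (gdsDualState L) (plusState (NewVertex L)) x =
      sgn (downCount L (x ∘ vertexBarycenter L)) * plusState (Barycenter L) x := by
  rw [← plusState_mul_plusState_vertexSplit, ← mul_assoc, ← gdsDualState_apply]
  rfl

end VertexSpins

end GDSDual

open GDSDual in
theorem mainTheorem7_general {V : Type*} [Fintype V] [DecidableEq V]
    (L : AbstractSimplicialComplex V) {R : ℕ} (hR : VertexBound L R)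
    (hL : ∀ s ∈ L.faces, 2 ≤ s.card → Even (eulerChar (link L s))) :
    ∃ c : Circuit (Barycenter L),
      c.IsLocallySymmetric ∧
      c.HasRange (barycentricSubdivision L) 4 ∧
      c.depth ≤ R ^ 8 + 1 ∧
      c.apply (tensorState (vertexSplit L) (gdsDualState L) (plusState (NewVertex L))) =
        gdsDualState (barycentricSubdivision L) := by
  obtain ⟨c, hsymm, hrange, hdepth, happly⟩ := exists_symmetric_circuit_apply_eq_sgn_sub_comp
    (K := barycentricSubdivision L) (π := vertexBarycenter L ∘ someVertex)
    (card_closedBall_one_barycentricSubdivision_le hR)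
    (fun s => mem_closedBall_one_barycentricSubdivision.2
      (Or.inl (vertexBarycenter_someVertex_le s)))
    ((dependsOn_downCount_add_one_sub hL).mono fun _ hs => vertexBarycenter_someVertex_eq hs)
  refine ⟨c, hsymm, hrange, hdepth.trans_le (by rw [← pow_mul]), funext fun x => ?_⟩
  rw [happly, ← Function.comp_assoc, downCount_barycentricSubdivision_comp someVertex_mem,
    tensorState_vertexSplit_apply, gdsDualState_apply, ← mul_assoc, ← AddChar.map_add_eq_mul,
    sub_add_cancel]

theorem mainTheorem7 :
    ∃ (r : ℕ) (f : ℕ → ℕ),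
      ∀ (V : Type*) [Fintype V] [DecidableEq V] (L : AbstractSimplicialComplex V) (d R : ℕ),
        GDSDual.HasDimension L d →
        GDSDual.VertexBound L R →
        (∀ s ∈ L.faces, s.card = d →
          ∃ a b : V, a ≠ b ∧ (GDSDual.link L s).faces = {{a}, {b}}) →
        (∀ s ∈ L.faces, 2 ≤ s.card → Even (GDSDual.eulerChar (GDSDual.link L s))) →
        ∃ c : GDSDual.Circuit (GDSDual.Barycenter L),
          c.IsLocallySymmetric ∧
          c.HasRange (GDSDual.barycentricSubdivision L) r ∧
          c.depth ≤ f R ∧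
          c.apply (GDSDual.tensorState (GDSDual.vertexSplit L) (GDSDual.gdsDualState L)
              (GDSDual.plusState (GDSDual.NewVertex L))) =
            GDSDual.gdsDualState (GDSDual.barycentricSubdivision L) :=
  ⟨4, fun R => R ^ 8 + 1, fun _ _ _ L _ _ _ hR _ hL => mainTheorem7_general L hR hL⟩
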